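/- Let $d\in\{1,2,3\}$, let $\Omega\subset\mathbb R^d$ be a bounded open set (in particular, $\Omega$ may be a bounded interval or a bounded polygonal/polyhedral domain), let $\nu>0$, $y_d\in L^2(\Omega)$ and $u_d\in L^\infty(\Omega)$. Consider the optimal control problem $$ \text{(P)}\qquad \begin{aligned} &\min_{(y,u)\in H^1_0(\Omega)\times L^2(\Omega)} J(y,u):=\tfrac12\|y-y_d\|_{L^2(\Omega)}^2+\tfrac{\nu}{2}\|u-u_d\|_{L^2(\Omega)}^2\\ &\text{s.t. } \int_\Omega \nabla y\cdot\nabla(v-y)\,dx+\|v\|_{L^1(\Omega)}-\|y\|_{L^1(\Omega)}\ \ge\ \int_\Omega u\,(v-y)\,dx\qquad\forall v\in H^1_0(\Omega). \end{aligned} $$ A control $\bar u\in L^2(\Omega)$ with associated state $\bar y\in H^1_0(\Omega)$ (i.e. $(\bar y,\bar u)$ satisfies the variational inequality) is called locally optimal if there is $\varepsilon>0$ such that $J(\bar y,\bar u)\le J(y,u)$ for every $u\in L^2(\Omega)$ with $\|u-\bar u\|_{L^2(\Omega)}\le\varepsilon$ and every $y\in H^1_0(\Omega)$ such that $(y,u)$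 satisfies the variational inequality. Then every locally optimal control $\bar u$ of (P) satisfies $\bar u\in L^\infty(\Omega)$ if $d=1$; $\bar u\in L^\kappa(\Omega)$ for every $\kappa\in[1,\infty)$ if $d=2$; and $\bar u\in L^6(\Omega)$ if $d=3$. -/

import Mathlib

open MeasureTheory
open scoped ENNReal

noncomputable section

namespace VIControl

open scoped ContDiff Gradient

/-- `L²(Ω)`, with respect to Lebesgue measure restricted to `Ω ⊆ ℝᵈ`. -/
abbrev L2 {d : ℕ} (Ω : Set (EuclideanSpace ℝ (Fin d))) : Type :=
  Lp ℝ 2 (volume.restrict Ω)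

/-- `L²(Ω; ℝᵈ)`, the space of square integrable vector fields on `Ω ⊆ ℝᵈ`. -/
abbrev L2Vec {d : ℕ} (Ω : Set (EuclideanSpace ℝ (Fin d))) : Type :=
  Lp (EuclideanSpace ℝ (Fin d)) 2 (volume.restrict Ω)

/-- The Hilbert space `L²(Ω) × L²(Ω; ℝᵈ)`. A function `y ∈ H¹(Ω)` is identified with the pair
`(y, ∇y)`, and the norm of that pair is the `H¹(Ω)` norm of `y`. -/
abbrev GraphSpace {d : ℕ} (Ω : Set (EuclideanSpace ℝ (Fin d))) : Type :=
  WithLp 2 (L2 Ω × L2Vec Ω)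

/-- The space `C_c^∞(Ω)` of test functions `φ`, embedded as the pairs `(φ, ∇φ)`. -/
def testFunctions {d : ℕ} (Ω : Set (EuclideanSpace ℝ (Fin d))) :
    Submodule ℝ (GraphSpace Ω) where
  carrier := {w | ∃ φ : EuclideanSpace ℝ (Fin d) → ℝ,
    ContDiff ℝ ∞ φ ∧ HasCompactSupport φ ∧ tsupport φ ⊆ Ω ∧
    w.fst =ᵐ[volume.restrict Ω] φ ∧ w.snd =ᵐ[volume.restrict Ω] ∇ φ}
  add_mem' := by
    rintro a b ⟨φ, h1, h2, h3, h4, h5⟩ ⟨ψ, k1, k2, k3, k4, k5⟩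
    refine ⟨φ + ψ, h1.add k1, h2.add k2,
      (tsupport_add φ ψ).trans (Set.union_subset h3 k3), ?_, ?_⟩
    · exact (Lp.coeFn_add a.fst b.fst).trans (h4.add k4)
    · have hg : ∇ (φ + ψ) = ∇ φ + ∇ ψ := by
        funext x
        simp only [gradient, Pi.add_apply]
        rw [fderiv_add (h1.differentiable (by simp) x) (k1.differentiable (by simp) x), map_add]
      rw [hg]
      exact (Lp.coeFn_add a.snd b.snd).trans (h5.add k5)
  zero_mem' := by
    refine ⟨0, contDiff_const, HasCompactSupport.zero, by simp, ?_, ?_⟩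
    · exact Lp.coeFn_zero _ _ _
    · have hg : ∇ (0 : EuclideanSpace ℝ (Fin d) → ℝ) = 0 := by
        funext x
        simp [gradient]
      rw [hg]
      exact Lp.coeFn_zero _ _ _
  smul_mem' := by
    rintro c a ⟨φ, h1, h2, h3, h4, h5⟩
    refine ⟨c • φ, h1.const_smul c, h2.mono (Function.support_const_smul_subset c φ),
      (closure_mono (Function.support_const_smul_subset c φ)).trans h3, ?_, ?_⟩
    · exact (Lp.coeFn_smul c a.fst).trans (h4.const_smul c)
    · have hg : ∇ (c • φ) = c • ∇ φ := by
        funext x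
        simp only [gradient, Pi.smul_apply]
        rw [fderiv_const_smul (h1.differentiable (by simp) x), map_smul]
      rw [hg]
      exact (Lp.coeFn_smul c a.snd).trans (h5.const_smul c)

/-- The Sobolev space `H¹₀(Ω)`: the closure of `C_c^∞(Ω)` in the `H¹(Ω)` norm. An element `y` is
the pair of the function `y.fst ∈ L²(Ω)` and its weak gradient `y.snd ∈ L²(Ω; ℝᵈ)`. -/
def H10 {d : ℕ} (Ω : Set (EuclideanSpace ℝ (Fin d))) : Submodule ℝ (GraphSpace Ω) :=
  (testFunctions Ω).topologicalClosure

/-- `y ∈ H¹₀(Ω)` is the state that belongs to the control `u ∈ L²(Ω)`, i.e. it solves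
`(∇y, ∇(v - y)) + ‖v‖_{L¹} - ‖y‖_{L¹} ≥ (u, v - y)` for all `v ∈ H¹₀(Ω)`. -/
def IsState {d : ℕ} (Ω : Set (EuclideanSpace ℝ (Fin d))) (u : L2 Ω) (y : GraphSpace Ω) : Prop :=
  y ∈ H10 Ω ∧ ∀ v ∈ H10 Ω,
    ∫ x in Ω, u x * (v.fst x - y.fst x) ≤
      (∫ x in Ω, inner ℝ (y.snd x) (v.snd x - y.snd x))
        + (∫ x in Ω, |v.fst x|) - ∫ x in Ω, |y.fst x|

/-- The objective `J(y, u) = ½ ‖y - y_d‖² + ν/2 ‖u - u_d‖²`, with `L²(Ω)` norms. -/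
def objective {d : ℕ} {Ω : Set (EuclideanSpace ℝ (Fin d))} (ν : ℝ) (yd ud : L2 Ω)
    (y : GraphSpace Ω) (u : L2 Ω) : ℝ :=
  1 / 2 * ‖y.fst - yd‖ ^ 2 + ν / 2 * ‖u - ud‖ ^ 2

/-- `ubar ∈ L²(Ω)` is a locally optimal control: together with its state it minimizes the objective
among all controls in an `L²(Ω)` ball around `ubar` and their states. -/
def IsLocallyOptimal {d : ℕ} (Ω : Set (EuclideanSpace ℝ (Fin d))) (ν : ℝ) (yd ud : L2 Ω)
    (ubar : L2 Ω) : Prop :=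
  ∃ ybar : GraphSpace Ω, IsState Ω ubar ybar ∧
    ∃ ε > 0, ∀ (u : L2 Ω) (y : GraphSpace Ω), ‖u - ubar‖ ≤ ε → IsState Ω u y →
      objective ν yd ud ybar ubar ≤ objective ν yd ud y u

end VIControl

end

/-!
With the energy inner product `(∇v, ∇w)`, which Poincaré's inequality makes equivalent to that of
`H¹₀(Ω)`, the state of a control `u` is the proximal point of `j(v) = ‖v‖_{L¹}` at `T† u`, where `T`
is the embedding of `H¹₀(Ω)` into `L²(Ω)`. Proximal maps are nonexpansive, so the control-to-state
map `S` satisfies `‖S u - S ū‖ ≤ ‖T† (u - ū)‖`. Although `S` is not differentiable, comparing `ū`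
with `ū + t k` as `t ↓ 0` gives `ν |(ū - u_d, k)| ≤ L ‖T† k‖` for all `k`, with `L` a local
Lipschitz constant of the tracking term. By the theorems of Hahn–Banach and Riesz, `ū - u_d` then
lies in the range of `T`, that is, in `H¹₀(Ω)`, and the Sobolev embedding gives its integrability.
-/

namespace VIControl

open Filter
open scoped ContDiff Gradient NNReal Topology InnerProductSpace

section StrongConvexity

variable {X : Type*} [NormedAddCommGroup X] [NormedSpace ℝ X] {F : X → ℝ} {m : ℝ}

theorem exists_isMinOn_of_strongConvexOn [CompleteSpace X] (hF : StrongConvexOn Set.univ m F)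
    (hm : 0 < m) (hlsc : LowerSemicontinuous F) (hbdd : BddBelow (Set.range F)) :
    ∃ x, IsMinOn F Set.univ x := by
  obtain ⟨a, ha_anti, ha_lim, ha_mem⟩ := exists_seq_tendsto_sInf (Set.range_nonempty F) hbdd
  choose x hx using ha_mem
  set I := sInf (Set.range F)
  have hI : ∀ y, I ≤ F y := fun y => csInf_le hbdd ⟨y, rfl⟩
  have hdist : ∀ n k, n ≤ k → dist (x n) (x k) ≤ √(8 / m * (a n - I)) := by
    intro n k hnk
    have hmid := hF.2 (Set.mem_univ (x n)) (Set.mem_univ (x k))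
      (show (0 : ℝ) ≤ 1 / 2 by norm_num) (by norm_num) (add_halves 1)
    have hle : I ≤ F ((1 / 2 : ℝ) • x n + (1 / 2 : ℝ) • x k) := hI _
    have hak : a k ≤ a n := ha_anti hnk
    rw [hx, hx] at hmid
    rw [dist_eq_norm]
    refine Real.le_sqrt_of_sq_le ?_
    rw [div_mul_eq_mul_div, le_div_iff₀ hm]
    simp only [smul_eq_mul] at hmid
    linarith
  have hlim : Tendsto (fun n => √(8 / m * (a n - I))) atTop (𝓝 0) := by
    simpa using ((ha_lim.sub_const I).const_mul (8 / m)).sqrt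
  obtain ⟨x₀, hx₀⟩ := cauchySeq_tendsto_of_complete (cauchySeq_of_le_tendsto_0' _ hdist hlim)
  have hmin : F x₀ ≤ I := by
    refine le_of_forall_gt_imp_ge_of_dense fun c hc => ?_
    refine (hlsc.isClosed_preimage c).mem_of_tendsto hx₀ ?_
    filter_upwards [ha_lim.eventually_lt_const hc] with n hn
    exact (hx n).trans_le hn.le
  exact ⟨x₀, fun y _ => hmin.trans (hI y)⟩

theorem add_norm_sub_sq_le_of_isMinOn (hF : StrongConvexOn Set.univ m F) {x : X}
    (hx : IsMinOn F Set.univ x) (y : X) : F x + m / 2 * ‖y - x‖ ^ 2 ≤ F y := by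
  have hlim : Tendsto (fun t : ℝ => F x + (1 - t) * (m / 2 * ‖y - x‖ ^ 2)) (𝓝[>] 0)
      (𝓝 (F x + m / 2 * ‖y - x‖ ^ 2)) :=
    (Continuous.tendsto' (by fun_prop) 0 _ (by simp)).mono_left nhdsWithin_le_nhds
  refine le_of_tendsto hlim ?_
  filter_upwards [Ioc_mem_nhdsGT (zero_lt_one' ℝ)] with t ⟨ht₀, ht₁⟩
  have hseg := hF.2 (Set.mem_univ y) (Set.mem_univ x) ht₀.le (sub_nonneg.2 ht₁) (by ring)
  have hmin : F x ≤ F (t • y + (1 - t) • x) := hx (Set.mem_univ _)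
  simp only [smul_eq_mul] at hseg
  refine le_of_mul_le_mul_left ?_ ht₀
  linarith

end StrongConvexity

section Prox

variable {V : Type*} [NormedAddCommGroup V] [InnerProductSpace ℝ V] {j : V → ℝ}

/-- `y` is the proximal point of `j` at `f`: for convex `j`, the minimizer of
`v ↦ j v + ½ ‖v - f‖²`, here encoded by its optimality condition `f - y ∈ ∂j(y)`. -/
def IsProx (j : V → ℝ) (f y : V) : Prop :=
  ∀ v, ⟪f - y, v - y⟫_ℝ ≤ j v - j y

theorem IsProx.norm_sub_le {f₁ f₂ y₁ y₂ : V} (h₁ : IsProx j f₁ y₁) (h₂ : IsProx j f₂ y₂) :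
    ‖y₁ - y₂‖ ≤ ‖f₁ - f₂‖ := by
  have hmono : ‖y₁ - y₂‖ * ‖y₁ - y₂‖ ≤ ⟪f₁ - f₂, y₁ - y₂⟫_ℝ := by
    have h₁₂ := h₁ y₂
    have h₂₁ := h₂ y₁
    rw [← real_inner_self_eq_norm_mul_norm]
    simp only [inner_sub_left, inner_sub_right] at *
    linarith
  rcases (norm_nonneg (y₁ - y₂)).eq_or_lt with h0 | hpos
  · exact h0 ▸ norm_nonneg _
  · exact le_of_mul_le_mul_right (hmono.trans (real_inner_le_norm _ _)) hpos

theorem strongConvexOn_add_norm_sub_sq (hj : ConvexOn ℝ Set.univ j) (f : V) :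
    StrongConvexOn Set.univ 1 fun v => j v + 1 / 2 * ‖v - f‖ ^ 2 := by
  rw [strongConvexOn_iff_convex]
  have haff : ConvexOn ℝ Set.univ fun v : V => -⟪f, v⟫_ℝ + 1 / 2 * ‖f‖ ^ 2 :=
    ((-innerSL ℝ f).toLinearMap.convexOn convex_univ).add_const _
  refine (hj.add haff).congr fun v _ => ?_
  simp only [Pi.add_apply, norm_sub_sq_real, real_inner_comm f v]
  ring

theorem exists_isProx [CompleteSpace V] (hconv : ConvexOn ℝ Set.univ j)
    (hlsc : LowerSemicontinuous j) (hbdd : BddBelow (Set.range j)) (f : V) :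
    ∃ y, IsProx j f y := by
  obtain ⟨c, hc⟩ := hbdd
  have hF := strongConvexOn_add_norm_sub_sq hconv f
  obtain ⟨y, hy⟩ := exists_isMinOn_of_strongConvexOn hF one_pos
    (hlsc.add (by fun_prop : Continuous fun v : V => 1 / 2 * ‖v - f‖ ^ 2).lowerSemicontinuous)
    ⟨c, by rintro _ ⟨v, rfl⟩; exact le_add_of_le_of_nonneg (hc ⟨v, rfl⟩) (by positivity)⟩
  refine ⟨y, fun v => ?_⟩
  have hgrowth := add_norm_sub_sq_le_of_isMinOn hF hy v
  have hsplit : ‖v - f‖ ^ 2 = ‖v - y‖ ^ 2 - 2 * ⟪f - y, v - y⟫_ℝ + ‖y - f‖ ^ 2 := by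
    rw [← sub_sub_sub_cancel_right v f y, norm_sub_sq_real, real_inner_comm, norm_sub_rev f y]
  linarith

end Prox

section Control

variable {V K : Type*} [NormedAddCommGroup V] [InnerProductSpace ℝ V] [CompleteSpace V]
  [NormedAddCommGroup K] [InnerProductSpace ℝ K] [CompleteSpace K]

theorem mem_range_of_inner_le_norm_adjoint (T : V →L[ℝ] K) {w : K} {C : ℝ≥0}
    (h : ∀ k, ⟪w, k⟫_ℝ ≤ C * ‖T.adjoint k‖) : w ∈ T.range := by
  have habs : ∀ k, |⟪w, k⟫_ℝ| ≤ C * ‖T.adjoint k‖ := fun k =>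
    abs_le'.2 ⟨h k, by simpa using h (-k)⟩
  obtain ⟨ψ, hψ⟩ : ∃ ψ : Module.Dual ℝ V, ∀ k, ψ (T.adjoint k) = ⟪w, k⟫_ℝ := by
    have hker : (innerSL ℝ w).toLinearMap ∈ T.adjoint.ker.dualAnnihilator := by
      rw [Submodule.mem_dualAnnihilator]
      intro k hk
      have hk : T.adjoint k = 0 := hk
      exact abs_nonpos_iff.1 ((habs k).trans_eq (by rw [hk, norm_zero, mul_zero]))
    rw [← LinearMap.range_dualMap_eq_dualAnnihilator_ker] at hker
    exact hker.imp fun ψ hψ k => LinearMap.congr_fun hψ k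
  obtain ⟨g, hg, -⟩ := Module.Dual.exists_continuous_extension_of_le_seminorm T.adjoint.range
    (ψ.domRestrict _) (p := C • normSeminorm ℝ V) (continuous_norm.const_smul C)
    (by rintro ⟨_, k, rfl⟩; exact (congrArg abs (hψ k)).trans_le (habs k))
  refine ⟨(InnerProductSpace.toDual ℝ V).symm g, ext_inner_right ℝ fun k => ?_⟩
  calc ⟪T ((InnerProductSpace.toDual ℝ V).symm g), k⟫_ℝ = g (T.adjoint k) := by
        rw [← ContinuousLinearMap.adjoint_inner_right, InnerProductSpace.toDual_symm_apply]
    _ = ⟪w, k⟫_ℝ := (hg ⟨_, k, rfl⟩).trans (hψ k)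

theorem sub_mem_range_of_isLocalMin (T : V →L[ℝ] K) {R : K → ℝ} {u₀ u_d : K} {L : ℝ≥0} {ν : ℝ}
    (hν : 0 < ν) (hR : ∀ᶠ u in 𝓝 u₀, R u - R u₀ ≤ L * ‖T.adjoint (u - u₀)‖)
    (hmin : IsLocalMin (fun u => R u + ν / 2 * ‖u - u_d‖ ^ 2) u₀) : u₀ - u_d ∈ T.range := by
  have hdir : ∀ k, 0 ≤ ν * ⟪u₀ - u_d, k⟫_ℝ + L * ‖T.adjoint k‖ := by
    intro k
    have hline : Tendsto (fun t : ℝ => u₀ + t • k) (𝓝[>] 0) (𝓝 u₀) :=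
      (Continuous.tendsto' (by fun_prop) 0 _ (by simp)).mono_left nhdsWithin_le_nhds
    have hlim : Tendsto (fun t : ℝ => ν * ⟪u₀ - u_d, k⟫_ℝ + L * ‖T.adjoint k‖
        + t * (ν / 2 * ‖k‖ ^ 2)) (𝓝[>] 0) (𝓝 (ν * ⟪u₀ - u_d, k⟫_ℝ + L * ‖T.adjoint k‖)) :=
      (Continuous.tendsto' (by fun_prop) 0 _ (by simp)).mono_left nhdsWithin_le_nhds
    refine ge_of_tendsto hlim ?_
    filter_upwards [hline.eventually hR, hline.eventually hmin, self_mem_nhdsWithin]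
      with t hRt hmint ht
    have ht : 0 < t := ht
    rw [add_sub_cancel_left, map_smul, norm_smul, Real.norm_of_nonneg ht.le] at hRt
    rw [add_sub_right_comm, norm_add_sq_real, inner_smul_right, norm_smul, mul_pow,
      Real.norm_of_nonneg ht.le] at hmint
    refine le_of_mul_le_mul_left ?_ ht
    linarith
  refine mem_range_of_inner_le_norm_adjoint T (C := L / ν.toNNReal) fun k => ?_
  have hk := hdir (-k)
  rw [inner_neg_right, map_neg, norm_neg] at hk
  rw [NNReal.coe_div, Real.coe_toNNReal ν hν.le, div_mul_eq_mul_div, le_div_iff₀ hν]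
  linarith

theorem sub_mem_range_of_locally_optimal (T : V →L[ℝ] K) {j : V → ℝ}
    (hconv : ConvexOn ℝ Set.univ j) (hlsc : LowerSemicontinuous j)
    (hbdd : BddBelow (Set.range j)) {g : V → ℝ} {ν : ℝ} (hν : 0 < ν) {u₀ u_d : K} {y₀ : V}
    {L : ℝ≥0} {s : Set V} (hs : s ∈ 𝓝 y₀) (hg : LipschitzOnWith L g s)
    (hy₀ : IsProx j (T.adjoint u₀) y₀)
    (hopt : ∀ᶠ u in 𝓝 u₀, ∀ y, IsProx j (T.adjoint u) y →
      g y₀ + ν / 2 * ‖u₀ - u_d‖ ^ 2 ≤ g y + ν / 2 * ‖u - u_d‖ ^ 2) :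
    u₀ - u_d ∈ T.range := by
  choose S hS using fun u => exists_isProx hconv hlsc hbdd (T.adjoint u)
  have hS_le : ∀ u, dist (S u) y₀ ≤ ‖T.adjoint (u - u₀)‖ := fun u => by
    rw [dist_eq_norm, map_sub]
    exact (hS u).norm_sub_le hy₀
  have hSu₀ : S u₀ = y₀ := dist_le_zero.1 ((hS_le u₀).trans_eq (by simp))
  have hS_lim : Tendsto S (𝓝 u₀) (𝓝 y₀) :=
    tendsto_iff_dist_tendsto_zero.2 (squeeze_zero (fun _ => dist_nonneg) hS_le
      (Continuous.tendsto' (by fun_prop) u₀ _ (by simp)))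
  refine sub_mem_range_of_isLocalMin T (R := g ∘ S) (L := L) hν ?_ ?_
  · filter_upwards [hS_lim hs] with u hu
    rw [Function.comp_apply, Function.comp_apply, hSu₀]
    calc g (S u) - g y₀ ≤ dist (g (S u)) (g y₀) := le_abs_self _
      _ ≤ L * dist (S u) y₀ := hg.dist_le_mul _ hu _ (mem_of_mem_nhds hs)
      _ ≤ L * ‖T.adjoint (u - u₀)‖ := by gcongr; exact hS_le u
  · filter_upwards [hopt] with u hu
    simpa [hSu₀] using hu (S u) (hS u)

end Control

section Sobolev
variable {d : ℕ} {Ω : Set (EuclideanSpace ℝ (Fin d))}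

/-- The Sobolev inequality `‖φ‖_{L^q(Ω)} ≤ C ‖∇φ‖_{L²(Ω)}` for all test functions `φ` on `Ω`. -/
def HasSobolevInequality (Ω : Set (EuclideanSpace ℝ (Fin d))) (q : ℝ≥0∞) : Prop :=
  ∃ C : ℝ≥0, ∀ φ : EuclideanSpace ℝ (Fin d) → ℝ,
    ContDiff ℝ ∞ φ → HasCompactSupport φ → tsupport φ ⊆ Ω →
      eLpNorm φ q (volume.restrict Ω) ≤ C * eLpNorm (∇ φ) 2 (volume.restrict Ω)

theorem rpow_one_div_sub_one_div_ne_top {a p q : ℝ≥0∞} (ha : a ≠ ⊤) (hp : p ≠ 0) (hpq : p ≤ q) :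
    a ^ (1 / p.toReal - 1 / q.toReal) ≠ ⊤ := by
  refine ENNReal.rpow_ne_top_of_nonneg ?_ ha
  simp only [one_div, ← ENNReal.toReal_inv]
  exact sub_nonneg.2 (ENNReal.toReal_mono (by simpa) (by simpa))

theorem HasSobolevInequality.mono (hΩ : volume Ω ≠ ⊤) {p q : ℝ≥0∞} (hpq : p ≤ q)
    (h : HasSobolevInequality Ω q) : HasSobolevInequality Ω p := by
  obtain ⟨C, hC⟩ := h
  rcases eq_or_ne p 0 with rfl | hp
  · exact ⟨0, by simp⟩
  have hfin := rpow_one_div_sub_one_div_ne_top hΩ hp hpq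
  refine ⟨(volume Ω ^ (1 / p.toReal - 1 / q.toReal)).toNNReal * C, fun φ hφ hsupp hφΩ => ?_⟩
  rw [ENNReal.coe_mul, ENNReal.coe_toNNReal hfin, mul_assoc, mul_comm]
  refine (eLpNorm_le_eLpNorm_mul_rpow_measure_univ hpq
    hφ.continuous.aestronglyMeasurable).trans ?_
  rw [Measure.restrict_apply_univ]
  gcongr
  exact hC φ hφ hsupp hφΩ

theorem eLpNorm_fderiv_le_eLpNorm_gradient {φ : EuclideanSpace ℝ (Fin d) → ℝ}
    (hφ : ContDiff ℝ 1 φ) (hφΩ : tsupport φ ⊆ Ω) {p r : ℝ≥0∞} (hpr : p ≤ r) :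
    eLpNorm (fderiv ℝ φ) p volume ≤
      eLpNorm (∇ φ) r (volume.restrict Ω) * volume Ω ^ (1 / p.toReal - 1 / r.toReal) := by
  have hnorm : eLpNorm (fderiv ℝ φ) p volume = eLpNorm (∇ φ) p volume :=
    eLpNorm_congr_norm_ae (.of_forall fun x => by rw [gradient, LinearIsometryEquiv.norm_map])
  have hsupp : Function.support (∇ φ) ⊆ Ω := fun x hx =>
    hφΩ (support_fderiv_subset ℝ fun h => hx (by rw [gradient, h, map_zero]))
  have hcont : Continuous (∇ φ) :=
    (InnerProductSpace.toDual ℝ _).symm.continuous.comp (hφ.continuous_fderiv one_ne_zero)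
  rw [hnorm, ← eLpNorm_restrict_eq_of_support_subset hsupp]
  simpa using eLpNorm_le_eLpNorm_mul_rpow_measure_univ (μ := volume.restrict Ω) hpr
    hcont.aestronglyMeasurable

theorem hasSobolevInequality_of_eLpNorm_le_fderiv (hΩ : volume Ω ≠ ⊤) {p q : ℝ≥0∞} (hp : p ≠ 0)
    (hp2 : p ≤ 2) {C : ℝ≥0} (h : ∀ φ : EuclideanSpace ℝ (Fin d) → ℝ, ContDiff ℝ 1 φ →
      HasCompactSupport φ → eLpNorm φ q ≤ C * eLpNorm (fderiv ℝ φ) p) :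
    HasSobolevInequality Ω q := by
  have hfin := rpow_one_div_sub_one_div_ne_top hΩ hp hp2
  refine ⟨C * (volume Ω ^ (1 / p.toReal - 1 / (2 : ℝ≥0∞).toReal)).toNNReal,
    fun φ hφ hsupp hφΩ => ?_⟩
  have hφ1 : ContDiff ℝ 1 φ := hφ.of_le (by simp)
  refine (eLpNorm_restrict_le φ q volume Ω).trans ((h φ hφ1 hsupp).trans ?_)
  rw [ENNReal.coe_mul, ENNReal.coe_toNNReal hfin, mul_assoc, mul_comm (volume Ω ^ _)]
  gcongr
  exact eLpNorm_fderiv_le_eLpNorm_gradient hφ1 hφΩ hp2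

theorem hasSobolevInequality_of_inv_eq (hΩ : volume Ω ≠ ⊤) (hd : d ≠ 0) {p q : ℝ≥0} (hp1 : 1 ≤ p)
    (hp2 : p ≤ 2) (hpq : (q : ℝ)⁻¹ = (p : ℝ)⁻¹ - (d : ℝ)⁻¹) : HasSobolevInequality Ω q :=
  hasSobolevInequality_of_eLpNorm_le_fderiv hΩ (p := p) (by positivity) (by exact_mod_cast hp2)
    fun _ hφ hsupp => eLpNorm_le_eLpNorm_fderiv_of_eq volume hφ hsupp hp1
      (by simpa using hd.bot_lt) (by simpa using hpq)

theorem hasSobolevInequality_one {Ω : Set (EuclideanSpace ℝ (Fin 1))} (hΩ : volume Ω ≠ ⊤) :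
    HasSobolevInequality Ω ⊤ := by
  refine hasSobolevInequality_of_eLpNorm_le_fderiv hΩ (p := 1) (C := 1) one_ne_zero
    one_le_two fun φ hφ hsupp => ?_
  rw [ENNReal.coe_one, one_mul, eLpNorm_exponent_top, eLpNorm_one_eq_lintegral_enorm]
  refine eLpNormEssSup_le_of_ae_enorm_bound (.of_forall fun x => ?_)
  let e : ℝ ≃ₗᵢ[ℝ] EuclideanSpace ℝ (Fin 1) := (OrthonormalBasis.singleton (Fin 1) ℝ).repr
  have hderiv (t : ℝ) : ‖deriv (φ ∘ e) t‖ = ‖fderiv ℝ φ (e t)‖ := by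
    rw [norm_deriv_eq_norm_fderiv,
      show fderiv ℝ (φ ∘ e) t = _ from e.toContinuousLinearEquiv.comp_right_fderiv]
    exact ContinuousLinearMap.opNorm_comp_linearIsometryEquiv _ e
  calc ‖φ x‖ₑ = ‖(φ ∘ e) (e.symm x)‖ₑ := by simp
    _ ≤ ∫⁻ t in Set.Iic (e.symm x), ‖deriv (φ ∘ e) t‖ₑ :=
        HasCompactSupport.enorm_le_lintegral_Ici_deriv (hφ.comp e.contDiff)
          (hsupp.comp_homeomorph e.toHomeomorph) _
    _ ≤ ∫⁻ t, ‖deriv (φ ∘ e) t‖ₑ := setLIntegral_le_lintegral _ _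
    _ = ∫⁻ t, ‖fderiv ℝ φ (e t)‖ₑ := by simp only [← ofReal_norm, hderiv]
    _ = ∫⁻ z, ‖fderiv ℝ φ z‖ₑ :=
        e.measurePreserving.lintegral_comp_emb e.toHomeomorph.measurableEmbedding
          fun z => ‖fderiv ℝ φ z‖ₑ

theorem hasSobolevInequality (hd : d ≠ 0) (hΩ : volume Ω ≠ ⊤) {q : ℝ≥0∞}
    (hq : 2⁻¹ ≤ q⁻¹ + (d : ℝ≥0∞)⁻¹) (hq2 : d = 2 → q ≠ ⊤) : HasSobolevInequality Ω q := by
  obtain rfl | rfl | hd3 : d = 1 ∨ d = 2 ∨ 2 < d := by omega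
  · exact (hasSobolevInequality_one hΩ).mono hΩ le_top
  · lift q to ℝ≥0 using hq2 rfl
    set r : ℝ≥0 := max q 2
    have hr : r⁻¹ ≤ 2⁻¹ := inv_anti₀ two_pos (le_max_right q 2)
    have : 0 < r := two_pos.trans_le (le_max_right q 2)
    refine (hasSobolevInequality_of_inv_eq (p := (r⁻¹ + 2⁻¹)⁻¹) (q := r) hΩ hd ?_ ?_ ?_).mono hΩ
      (by exact_mod_cast le_max_left q 2)
    · rw [one_le_inv₀ (by positivity)]
      exact (add_le_add_left hr _).trans_eq (by rw [← two_mul, mul_inv_cancel₀ two_ne_zero])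
    · rw [inv_le_comm₀ (by positivity) two_pos]
      exact le_add_self
    · simp
  · have hlt : (d : ℝ≥0)⁻¹ < 2⁻¹ := inv_strictAnti₀ two_pos (by exact_mod_cast hd3)
    have hsub : 0 < (2 : ℝ≥0)⁻¹ - (d : ℝ≥0)⁻¹ := tsub_pos_of_lt hlt
    refine (hasSobolevInequality_of_inv_eq (p := 2) (q := (2⁻¹ - (d : ℝ≥0)⁻¹)⁻¹) hΩ hd one_le_two
      le_rfl ?_).mono hΩ ?_
    · simp [NNReal.coe_sub hlt.le]
    · rw [← ENNReal.inv_le_inv, ENNReal.coe_inv hsub.ne', inv_inv, ENNReal.coe_sub,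
        tsub_le_iff_right]
      simpa [ENNReal.coe_inv, hd] using hq

end Sobolev

section IntegrableNorm

variable {α : Type*} [MeasurableSpace α]

/-- The inclusion `L²(μ) → L¹(μ)` of a finite measure, as multiplication by the constant `1`. -/
noncomputable def toL1 (μ : Measure α) [IsFiniteMeasure μ] : Lp ℝ 2 μ →L[ℝ] Lp ℝ 1 μ :=
  (ContinuousLinearMap.mul ℝ ℝ).holderL μ 2 2 1 (Lp.const 2 μ 1)

theorem norm_toL1 (μ : Measure α) [IsFiniteMeasure μ] (w : Lp ℝ 2 μ) :
    ‖toL1 μ w‖ = ∫ x, |w x| ∂μ := by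
  rw [L1.norm_eq_integral_norm]
  refine integral_congr_ae ?_
  filter_upwards [(ContinuousLinearMap.mul ℝ ℝ).coeFn_holder (r := 1) (Lp.const 2 μ 1) w,
    Lp.coeFn_const 2 μ (1 : ℝ)] with x hmul hone
  rw [toL1, ContinuousLinearMap.holderL_apply_apply, hmul, hone]
  simp

end IntegrableNorm

section H10

variable {d : ℕ} {Ω : Set (EuclideanSpace ℝ (Fin d))}

theorem eLpNorm_fst_le_of_mem_H10 {q : ℝ≥0∞} {C : ℝ≥0}
    (h : ∀ φ : EuclideanSpace ℝ (Fin d) → ℝ, ContDiff ℝ ∞ φ → HasCompactSupport φ → tsupport φ ⊆ Ω →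
      eLpNorm φ q (volume.restrict Ω) ≤ C * eLpNorm (∇ φ) 2 (volume.restrict Ω))
    {w : GraphSpace Ω} (hw : w ∈ H10 Ω) :
    eLpNorm w.fst q (volume.restrict Ω) ≤ C * ‖w.snd‖ₑ := by
  obtain ⟨s, hs, hlim⟩ := mem_closure_iff_seq_limit.1
    (show w ∈ closure (testFunctions Ω : Set (GraphSpace Ω)) from hw)
  have hfst : Tendsto (fun n => (s n).fst) atTop (𝓝 w.fst) :=
    ((WithLp.prod_continuous_ofLp 2 _ _).fst.tendsto w).comp hlim
  have hsnd : Tendsto (fun n => (s n).snd) atTop (𝓝 w.snd) :=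
    ((WithLp.prod_continuous_ofLp 2 _ _).snd.tendsto w).comp hlim
  obtain ⟨ns, hns, hae⟩ := (tendstoInMeasure_of_tendsto_Lp hfst).exists_seq_tendsto_ae
  have hbound (n : ℕ) : eLpNorm (s n).fst q (volume.restrict Ω) ≤ C * ‖(s n).snd‖ₑ := by
    obtain ⟨φ, hφ, hsupp, hφΩ, hfst_eq, hsnd_eq⟩ := hs n
    rw [eLpNorm_congr_ae hfst_eq, Lp.enorm_def, eLpNorm_congr_ae hsnd_eq]
    exact h φ hφ hsupp hφΩ
  have hbound_lim : Tendsto (fun n => (C : ℝ≥0∞) * ‖(s (ns n)).snd‖ₑ) atTop (𝓝 (C * ‖w.snd‖ₑ)) :=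
    ENNReal.Tendsto.const_mul (hsnd.comp hns.tendsto_atTop).enorm (.inr ENNReal.coe_ne_top)
  calc eLpNorm w.fst q (volume.restrict Ω)
      ≤ liminf (fun n => eLpNorm (s (ns n)).fst q (volume.restrict Ω)) atTop :=
        Lp.eLpNorm_lim_le_liminf_eLpNorm (fun n => Lp.aestronglyMeasurable _) _ hae
    _ ≤ liminf (fun n => (C : ℝ≥0∞) * ‖(s (ns n)).snd‖ₑ) atTop :=
        liminf_le_liminf (.of_forall fun n => hbound (ns n))
    _ = C * ‖w.snd‖ₑ := hbound_lim.liminf_eq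

theorem HasSobolevInequality.memLp_fst {q : ℝ≥0∞} (h : HasSobolevInequality Ω q)
    {w : GraphSpace Ω} (hw : w ∈ H10 Ω) : MemLp w.fst q (volume.restrict Ω) := by
  obtain ⟨C, hC⟩ := h
  exact ⟨Lp.aestronglyMeasurable _, (eLpNorm_fst_le_of_mem_H10 hC hw).trans_lt
    (ENNReal.mul_lt_top ENNReal.coe_lt_top enorm_lt_top)⟩

instance : CompleteSpace (H10 Ω) :=
  (testFunctions Ω).isClosed_topologicalClosure.completeSpace_coe

/-- The embedding of `H¹₀(Ω)` into `L²(Ω)`. -/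
noncomputable def embedding (Ω : Set (EuclideanSpace ℝ (Fin d))) : H10 Ω →L[ℝ] L2 Ω :=
  (WithLp.fstL 2 ℝ (L2 Ω) (L2Vec Ω)).comp (H10 Ω).subtypeL

/-- The weak gradient of a function in `H¹₀(Ω)`. -/
noncomputable def weakGradient (Ω : Set (EuclideanSpace ℝ (Fin d))) : H10 Ω →L[ℝ] L2Vec Ω :=
  (WithLp.sndL 2 ℝ (L2 Ω) (L2Vec Ω)).comp (H10 Ω).subtypeL

theorem HasSobolevInequality.antilipschitzWith_weakGradient (h : HasSobolevInequality Ω 2) :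
    ∃ C, AntilipschitzWith C (weakGradient Ω) := by
  obtain ⟨C, hC⟩ := h
  refine ⟨C + 1, (weakGradient Ω).antilipschitz_of_bound fun v => ?_⟩
  have hfst : ‖(v : GraphSpace Ω).fst‖ ≤ C * ‖weakGradient Ω v‖ := by
    have hle := eLpNorm_fst_le_of_mem_H10 hC v.2
    rw [← Lp.enorm_def] at hle
    have := ENNReal.toReal_mono (by finiteness) hle
    rwa [ENNReal.toReal_mul, ENNReal.coe_toReal, toReal_enorm, toReal_enorm] at this
  refine le_of_sq_le_sq ?_ (by positivity)
  calc ‖v‖ ^ 2 = ‖(v : GraphSpace Ω).fst‖ ^ 2 + ‖weakGradient Ω v‖ ^ 2 :=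
        WithLp.prod_norm_sq_eq_of_L2 _
    _ ≤ (C * ‖weakGradient Ω v‖) ^ 2 + ‖weakGradient Ω v‖ ^ 2 := by gcongr
    _ ≤ ((C + 1 : ℝ≥0) * ‖weakGradient Ω v‖) ^ 2 := by
        push_cast
        linarith [show 0 ≤ C * ‖weakGradient Ω v‖ * ‖weakGradient Ω v‖ by positivity]

theorem inner_eq_setIntegral_mul_sub (u v w : L2 Ω) :
    ⟪u, v - w⟫_ℝ = ∫ x in Ω, u x * (v x - w x) := by
  rw [L2.inner_def]
  refine integral_congr_ae ?_
  filter_upwards [Lp.coeFn_sub v w] with x hx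
  rw [hx, Pi.sub_apply, real_inner_comm]
  rfl

theorem inner_eq_setIntegral_inner_sub (u v w : L2Vec Ω) :
    ⟪u, v - w⟫_ℝ = ∫ x in Ω, ⟪u x, v x - w x⟫_ℝ := by
  rw [L2.inner_def]
  refine integral_congr_ae ?_
  filter_upwards [Lp.coeFn_sub v w] with x hx
  rw [hx, Pi.sub_apply]

theorem isState_coe_iff [IsFiniteMeasure (volume.restrict Ω)] (u : L2 Ω) (y : H10 Ω) :
    IsState Ω u y ↔ ∀ v : H10 Ω, ⟪u, embedding Ω v - embedding Ω y⟫_ℝ ≤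
      ⟪weakGradient Ω y, weakGradient Ω v - weakGradient Ω y⟫_ℝ
        + ‖toL1 _ (embedding Ω v)‖ - ‖toL1 _ (embedding Ω y)‖ := by
  simp only [inner_eq_setIntegral_mul_sub, inner_eq_setIntegral_inner_sub, norm_toL1]
  exact ⟨fun h v => h.2 v v.2, fun h => ⟨y.2, fun v hv => h ⟨v, hv⟩⟩⟩

theorem isState_iff_isProx [IsFiniteMeasure (volume.restrict Ω)] {V : Type*}
    [NormedAddCommGroup V] [InnerProductSpace ℝ V] [CompleteSpace V] (e : H10 Ω ≃L[ℝ] V)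
    (he : ∀ v w, ⟪e v, e w⟫_ℝ = ⟪weakGradient Ω v, weakGradient Ω w⟫_ℝ) (u : L2 Ω) (y : H10 Ω) :
    IsState Ω u y ↔ IsProx (fun z => ‖toL1 _ (embedding Ω (e.symm z))‖)
      ((embedding Ω ∘L e.symm.toContinuousLinearMap).adjoint u) (e y) := by
  rw [isState_coe_iff, IsProx, e.surjective.forall]
  refine forall_congr' fun v => ?_
  rw [inner_sub_left, ContinuousLinearMap.adjoint_inner_left, ← map_sub e, he,
    ContinuousLinearMap.comp_apply, ContinuousLinearEquiv.coe_coe]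
  simp only [e.symm_apply_apply, map_sub]
  rw [sub_le_iff_le_add', add_sub_assoc]

theorem IsLocallyOptimal.exists_mem_H10 (hΩ : volume Ω ≠ ⊤) (hP : HasSobolevInequality Ω 2)
    {ν : ℝ} (hν : 0 < ν) {yd ud ubar : L2 Ω} (h : IsLocallyOptimal Ω ν yd ud ubar) :
    ∃ p ∈ H10 Ω, p.fst = ubar - ud := by
  have : IsFiniteMeasure (volume.restrict Ω) := isFiniteMeasure_restrict.2 hΩ
  obtain ⟨C, hC⟩ := hP.antilipschitzWith_weakGradient
  have hclosed := hC.isClosed_range (weakGradient Ω).uniformContinuous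
  have : CompleteSpace (weakGradient Ω).range := hclosed.completeSpace_coe
  let e := (weakGradient Ω).equivRange hC.injective hclosed
  have hstate := isState_iff_isProx e fun _ _ => rfl
  obtain ⟨ybar, hybar, ε, hε, hopt⟩ := h
  have hy := (hstate ubar ⟨ybar, hybar.1⟩).1 hybar
  let T := embedding Ω ∘L e.symm.toContinuousLinearMap
  obtain ⟨L, s, hs, hL⟩ : ∃ L, ∃ s ∈ 𝓝 (e ⟨ybar, hybar.1⟩),
      LipschitzOnWith L (fun z => 1 / 2 * ‖T z - yd‖ ^ 2) s :=
    ((contDiff_const.mul ((T.contDiff.sub contDiff_const).norm_sq ℝ)).contDiffAt (n := 1))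
      |>.exists_lipschitzOnWith
  have hconv : ConvexOn ℝ Set.univ fun z => ‖toL1 _ (embedding Ω (e.symm z))‖ :=
    convexOn_univ_norm.comp_linearMap ((toL1 _) ∘L T).toLinearMap
  have hlsc : LowerSemicontinuous fun z => ‖toL1 _ (embedding Ω (e.symm z))‖ :=
    Continuous.lowerSemicontinuous (by fun_prop)
  have hopt_prox : ∀ᶠ u in 𝓝 ubar, ∀ z,
      IsProx (fun z => ‖toL1 _ (embedding Ω (e.symm z))‖) (T.adjoint u) z →
        1 / 2 * ‖T (e ⟨ybar, hybar.1⟩) - yd‖ ^ 2 + ν / 2 * ‖ubar - ud‖ ^ 2 ≤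
          1 / 2 * ‖T z - yd‖ ^ 2 + ν / 2 * ‖u - ud‖ ^ 2 := by
    filter_upwards [Metric.closedBall_mem_nhds ubar hε] with u hu z hz
    obtain ⟨y, rfl⟩ := e.surjective z
    simpa [T, objective, embedding] using
      hopt u y (mem_closedBall_iff_norm.1 hu) ((hstate u y).2 hz)
  obtain ⟨z, hz⟩ := sub_mem_range_of_locally_optimal T hconv hlsc
    ⟨0, by rintro _ ⟨z, rfl⟩; positivity⟩ hν hs hL hy hopt_prox
  exact ⟨e.symm z, (e.symm z).2, hz⟩

end H10

end VIControl

theorem proposition2p5_general {d : ℕ} (hd : d ≠ 0) {Ω : Set (EuclideanSpace ℝ (Fin d))}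
    (hΩ : volume Ω ≠ ∞) {ν : ℝ} (hν : 0 < ν) {yd ud ubar : VIControl.L2 Ω}
    (hubar : VIControl.IsLocallyOptimal Ω ν yd ud ubar) {q : ℝ≥0∞}
    (hq : 2⁻¹ ≤ q⁻¹ + (d : ℝ≥0∞)⁻¹) (hq2 : d = 2 → q ≠ ∞)
    (hud : MemLp ud q (volume.restrict Ω)) : MemLp ubar q (volume.restrict Ω) := by
  have hPoincare : VIControl.HasSobolevInequality Ω 2 :=
    VIControl.hasSobolevInequality hd hΩ le_self_add fun _ => by simp
  obtain ⟨p, hp, hp_eq⟩ := hubar.exists_mem_H10 hΩ hPoincare hν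
  have hdiff : MemLp (ubar - ud : VIControl.L2 Ω) q (volume.restrict Ω) :=
    hp_eq ▸ (VIControl.hasSobolevInequality hd hΩ hq hq2).memLp_fst hp
  refine (hdiff.add hud).ae_eq ?_
  filter_upwards [Lp.coeFn_sub ubar ud] with x hx
  rw [Pi.add_apply, hx, Pi.sub_apply, sub_add_cancel]

theorem proposition2p5 {d : ℕ} (Ω : Set (EuclideanSpace ℝ (Fin d)))
    (hΩ_open : IsOpen Ω) (hΩ_bdd : Bornology.IsBounded Ω)
    (ν : ℝ) (hν : 0 < ν)
    (yd ud : VIControl.L2 Ω) (hud : MemLp ud ∞ (volume.restrict Ω))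
    (ubar : VIControl.L2 Ω) (hubar : VIControl.IsLocallyOptimal Ω ν yd ud ubar) :
    (d = 1 → MemLp ubar ∞ (volume.restrict Ω)) ∧
    (d = 2 → ∀ κ : ℝ≥0∞, 1 ≤ κ → κ < ∞ → MemLp ubar κ (volume.restrict Ω)) ∧
    (d = 3 → MemLp ubar 6 (volume.restrict Ω)) := by
  have hΩ : volume Ω ≠ ∞ := hΩ_bdd.measure_lt_top.ne
  have : IsFiniteMeasure (volume.restrict Ω) := isFiniteMeasure_restrict.2 hΩ
  have hmem {q : ℝ≥0∞} (hd : d ≠ 0) (hq : 2⁻¹ ≤ q⁻¹ + (d : ℝ≥0∞)⁻¹) (hq2 : d = 2 → q ≠ ∞) :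
      MemLp ubar q (volume.restrict Ω) :=
    proposition2p5_general hd hΩ hν hubar hq hq2 (hud.mono_exponent le_top)
  refine ⟨?_, ?_, ?_⟩
  · rintro rfl
    exact hmem one_ne_zero (by simp) (by simp)
  · rintro rfl κ - hκ
    exact hmem two_ne_zero le_add_self fun _ => hκ.ne
  · rintro rfl
    have : (2 : ℝ≥0∞)⁻¹ = 6⁻¹ + 3⁻¹ := by
      rw [← ENNReal.toReal_eq_toReal_iff' (by finiteness) (by finiteness)]
      norm_num [ENNReal.toReal_add]
    exact hmem three_ne_zero this.le (by simp)
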